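/- There is an absolute constant $c>0$ such that for every finite set $A\subset\mathbb{R}$ with $|A|\ge 3$ and every real number $\alpha$ that is transcendental (over $\mathbb{Q}$), $$|A+\alpha.A| \;\ge\; c\,\frac{(\log|A|)^{4/3}}{(\log\log|A|)^{8/3}}\,|A|,$$ where $\alpha.A:=\{\alpha a : a\in A\}$ and $A+\alpha.A:=\{a+\alpha b : a,b\in A\}$. -/

import Mathlib

open scoped Pointwise

/-! Since α is transcendental, ℝ is a vector space over ℚ(X) with X acting as α. A linear functional
injective on `A`, with denominators cleared, turns `A` into a set of polynomials, i.e. of finitely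
supported rational sequences, and multiplication by α into the shift. Compressing in every
coordinate then gives a lower set in ℕ^d of the same size n whose sum with its shift is no larger
(`exists_isLowerSet_card_add_shiftRight_le`).

For such a lower set let N be the size of the sum with the shift. Cutting a point at a coordinate i
and shifting the upper part opens a gap, so points with x_i = m are at most N/(m+1)² in number. Only
about N log n / n coordinates are active, so if N is below n(log n)² at least half of the set lies
in a box whose side is a power of log n.

In a box of side M, sums of lower sets satisfy |A+B| ≥ (|A||B|)^((1+ε)/2) in every dimension, with ε
of order 1/log M (`rpow_card_mul_card_le_card_add`). This tensorizes a one-dimensional inequality of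
Prékopa–Leindler type. Hence N ≥ (n/2)^(1+ε) with ε of order 1/log log n, which exceeds n(log n)²
for large n, a contradiction. The resulting bound n(log n)² dominates the required one; small sets
are absorbed in the constant. -/

/-- The right shift of a sequence. -/
def shiftRight {R : Type*} [Zero R] (x : ℕ → R) : ℕ → R
  | 0 => 0
  | n + 1 => x n

@[simp] lemma shiftRight_zero {R : Type*} [Zero R] (x : ℕ → R) : shiftRight x 0 = 0 := rfl

@[simp] lemma shiftRight_succ {R : Type*} [Zero R] (x : ℕ → R) (n : ℕ) :
    shiftRight x (n + 1) = x n := rfl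

lemma shiftRight_injective {R : Type*} [Zero R] :
    Function.Injective (shiftRight : (ℕ → R) → ℕ → R) := fun x y h => by
  funext n
  simpa using congrFun h (n + 1)

lemma shiftRight_update {R : Type*} [Zero R] (x : ℕ → R) (i : ℕ) (a : R) :
    shiftRight (Function.update x i a) = Function.update (shiftRight x) (i + 1) a := by
  funext n
  cases n with
  | zero => simp
  | succ n => simp [Function.update_apply]

/-! ### Compression in one coordinate direction -/

open Classical in
/-- The points of `A` that agree with `z` off the coordinate `i`. -/
noncomputable def lineFiber (A : Finset (ℕ → ℚ)) (i : ℕ) (z : ℕ → ℚ) : Finset (ℕ → ℚ) :=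
  A.filter fun y => Function.update y i 0 = Function.update z i 0

open Classical in
/-- Compression in direction `i`: each fiber in this direction is replaced by an initial segment
of the natural numbers of the same size. -/
noncomputable def compress (i : ℕ) (A : Finset (ℕ → ℚ)) : Finset (ℕ → ℚ) :=
  A.biUnion fun x =>
    (Finset.range (lineFiber A i x).card).image fun k : ℕ => Function.update x i (k : ℚ)

lemma mem_lineFiber {A : Finset (ℕ → ℚ)} {i : ℕ} {y z : ℕ → ℚ} :
    y ∈ lineFiber A i z ↔ y ∈ A ∧ Function.update y i 0 = Function.update z i 0 := by
  classical
  simp [lineFiber]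

lemma lineFiber_congr {A : Finset (ℕ → ℚ)} {i : ℕ} {y z : ℕ → ℚ}
    (h : Function.update y i 0 = Function.update z i 0) : lineFiber A i y = lineFiber A i z := by
  ext x
  rw [mem_lineFiber, mem_lineFiber, h]

lemma update_eq_of_update_zero_eq {i : ℕ} {y z : ℕ → ℚ}
    (h : Function.update y i 0 = Function.update z i 0) : Function.update y i (z i) = z := by
  have := congrArg (fun f => Function.update f i (z i)) h
  simpa using this

lemma eval_injOn_lineFiber (A : Finset (ℕ → ℚ)) (i : ℕ) (z : ℕ → ℚ) :
    Set.InjOn (Pi.evalAddHom (fun _ : ℕ => ℚ) i) (lineFiber A i z) := by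
  intro y hy y' hy' h
  have h1 := (mem_lineFiber.1 hy).2.trans (mem_lineFiber.1 hy').2.symm
  rw [← update_eq_of_update_zero_eq h1, ← show y i = y' i from h, Function.update_eq_self]

lemma mem_compress {i : ℕ} {A : Finset (ℕ → ℚ)} {z : ℕ → ℚ} :
    z ∈ compress i A ↔ ∃ k : ℕ, z i = k ∧ k < (lineFiber A i z).card := by
  classical
  simp only [compress, Finset.mem_biUnion, Finset.mem_image, Finset.mem_range]
  constructor
  · rintro ⟨x, hx, k, hk, rfl⟩
    refine ⟨k, by simp, ?_⟩
    rwa [lineFiber_congr (z := x) (by simp)]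
  · rintro ⟨k, hzk, hk⟩
    obtain ⟨x, hx⟩ := Finset.card_pos.1 (by omega : 0 < (lineFiber A i z).card)
    obtain ⟨hxA, hxz⟩ := mem_lineFiber.1 hx
    refine ⟨x, hxA, k, ?_, ?_⟩
    · rwa [lineFiber_congr hxz]
    · rw [← hzk]
      exact update_eq_of_update_zero_eq hxz

lemma card_compress (i : ℕ) (A : Finset (ℕ → ℚ)) : (compress i A).card = A.card := by
  classical
  let f : (ℕ → ℚ) → ℕ → ℚ := fun x => Function.update x i 0
  have h1 : ∀ x ∈ A, f x ∈ A.image f := fun x hx => Finset.mem_image_of_mem f hx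
  have h2 : ∀ z ∈ compress i A, f z ∈ A.image f := by
    intro z hz
    obtain ⟨k, -, hk⟩ := mem_compress.1 hz
    obtain ⟨x, hx⟩ := Finset.card_pos.1 (by omega : 0 < (lineFiber A i z).card)
    obtain ⟨hxA, hxz⟩ := mem_lineFiber.1 hx
    exact Finset.mem_image.2 ⟨x, hxA, hxz⟩
  rw [Finset.card_eq_sum_card_fiberwise h1, Finset.card_eq_sum_card_fiberwise h2]
  refine Finset.sum_congr rfl fun b hb => ?_
  obtain ⟨x, hx, rfl⟩ := Finset.mem_image.1 hb
  have : (compress i A).filter (fun z => f z = f x) =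
      (Finset.range (lineFiber A i x).card).image fun k : ℕ => Function.update x i (k : ℚ) := by
    ext z
    simp only [Finset.mem_filter, Finset.mem_image, Finset.mem_range, mem_compress]
    constructor
    · rintro ⟨⟨k, hzk, hk⟩, hzx⟩
      refine ⟨k, ?_, ?_⟩
      · rwa [← lineFiber_congr hzx]
      · rw [← hzk]
        exact update_eq_of_update_zero_eq hzx.symm
    · rintro ⟨k, hk, rfl⟩
      refine ⟨⟨k, by simp, ?_⟩, by simp [f]⟩
      rwa [lineFiber_congr (z := x) (by simp)]
  rw [this, Finset.card_image_of_injective, Finset.card_range]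
  · rfl
  · intro a b hab
    have := congrFun hab i
    simpa using this

-- Fiberwise Cauchy–Davenport in ℚ: nonempty fibers satisfy |F + G| ≥ |F| + |G| - 1, and heights k <
-- |F|, l < |G| give k + l < |F| + |G| - 1.
open Classical in
lemma compress_add_subset (i : ℕ) (A B : Finset (ℕ → ℚ)) :
    compress i A + compress i B ⊆ compress i (A + B) := by
  intro z hz
  obtain ⟨x, hx, y, hy, rfl⟩ := Finset.mem_add.1 hz
  obtain ⟨k, hxk, hk⟩ := mem_compress.1 hx
  obtain ⟨l, hyl, hl⟩ := mem_compress.1 hy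
  refine mem_compress.2 ⟨k + l, by simp [hxk, hyl], ?_⟩
  set F := lineFiber A i x with hF
  set G := lineFiber B i y with hG
  have hsub : F + G ⊆ lineFiber (A + B) i (x + y) := by
    intro w hw
    obtain ⟨a, ha, b, hb, rfl⟩ := Finset.mem_add.1 hw
    obtain ⟨ha1, ha2⟩ := mem_lineFiber.1 ha
    obtain ⟨hb1, hb2⟩ := mem_lineFiber.1 hb
    refine mem_lineFiber.2 ⟨Finset.add_mem_add ha1 hb1, ?_⟩
    have e : ∀ u v : ℕ → ℚ,
        Function.update (u + v) i 0 = Function.update u i 0 + Function.update v i 0 := by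
      intro u v
      rw [← Function.update_add, add_zero]
    rw [e, e, ha2, hb2]
  have hFne : (F.image (Pi.evalAddHom (fun _ : ℕ => ℚ) i)).Nonempty :=
    (Finset.card_pos.1 (by omega)).image _
  have hGne : (G.image (Pi.evalAddHom (fun _ : ℕ => ℚ) i)).Nonempty :=
    (Finset.card_pos.1 (by omega)).image _
  have h := cauchy_davenport_add_of_linearOrder_isCancelAdd hFne hGne
  rw [← Finset.image_add, Finset.card_image_of_injOn (eval_injOn_lineFiber A i x),
    Finset.card_image_of_injOn (eval_injOn_lineFiber B i y), ← hF, ← hG] at h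
  have h3 := (h.trans Finset.card_image_le).trans (Finset.card_le_card hsub)
  omega

lemma compress_mono (i : ℕ) {A B : Finset (ℕ → ℚ)} (h : A ⊆ B) : compress i A ⊆ compress i B := by
  intro z hz
  obtain ⟨k, hzk, hk⟩ := mem_compress.1 hz
  refine mem_compress.2 ⟨k, hzk, hk.trans_le (Finset.card_le_card fun y hy => ?_)⟩
  rw [mem_lineFiber] at hy ⊢
  exact ⟨h hy.1, hy.2⟩

lemma compress_eq_self {i : ℕ} {A : Finset (ℕ → ℚ)} (h : ∀ x ∈ A, x i = 0) :
    compress i A = A := by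
  refine (Finset.eq_of_subset_of_card_le (fun z hz => ?_) (card_compress i A).le).symm
  refine mem_compress.2 ⟨0, by simp [h z hz], Finset.card_pos.2 ⟨z, mem_lineFiber.2 ⟨hz, rfl⟩⟩⟩

-- The shift carries fibers in direction `i` bijectively to fibers in direction `i + 1`, so it
-- intertwines the two compressions.
open Classical in
lemma image_shiftRight_compress (i : ℕ) (A : Finset (ℕ → ℚ)) :
    (compress i A).image shiftRight = compress (i + 1) (A.image shiftRight) := by
  have hfib : ∀ x : ℕ → ℚ,
      lineFiber (A.image shiftRight) (i + 1) (shiftRight x) = (lineFiber A i x).image shiftRight := by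
    intro x
    ext y
    simp only [mem_lineFiber, Finset.mem_image]
    constructor
    · rintro ⟨⟨a, ha, rfl⟩, h⟩
      rw [← shiftRight_update, ← shiftRight_update] at h
      exact ⟨a, ⟨ha, shiftRight_injective h⟩, rfl⟩
    · rintro ⟨a, ⟨ha, h⟩, rfl⟩
      refine ⟨⟨a, ha, rfl⟩, ?_⟩
      rw [← shiftRight_update, ← shiftRight_update, h]
  simp only [compress, Finset.biUnion_image, Finset.image_biUnion, Finset.image_image]
  refine Finset.biUnion_congr rfl fun x _ => ?_
  rw [hfib, Finset.card_image_of_injective _ shiftRight_injective]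
  refine Finset.image_congr fun k _ => ?_
  simp [shiftRight_update]

lemma compress_supported {A : Finset (ℕ → ℚ)} {d i : ℕ} (hi : i < d)
    (h : ∀ x ∈ A, ∀ k, d ≤ k → x k = 0) : ∀ x ∈ compress i A, ∀ k, d ≤ k → x k = 0 := by
  classical
  intro z hz k hk
  simp only [compress, Finset.mem_biUnion, Finset.mem_image, Finset.mem_range] at hz
  obtain ⟨x, hx, l, -, rfl⟩ := hz
  rw [Function.update_of_ne (by omega)]
  exact h x hx k hk

/-- All coordinates `j` of points of `A` are natural numbers which may be lowered within `A`. -/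
def IsClosedInDirection (j : ℕ) (A : Finset (ℕ → ℚ)) : Prop :=
  ∀ x ∈ A, ∃ k : ℕ, x j = k ∧ ∀ m ≤ k, Function.update x j (m : ℚ) ∈ A

lemma isClosedInDirection_compress_self (i : ℕ) (A : Finset (ℕ → ℚ)) :
    IsClosedInDirection i (compress i A) := by
  intro x hx
  obtain ⟨k, hxk, hk⟩ := mem_compress.1 hx
  refine ⟨k, hxk, fun m hm => mem_compress.2 ⟨m, by simp, ?_⟩⟩
  rw [lineFiber_congr (z := x) (by simp)]
  omega

lemma IsClosedInDirection.compress {j : ℕ} {A : Finset (ℕ → ℚ)} (h : IsClosedInDirection j A)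
    (i : ℕ) : IsClosedInDirection j (compress i A) := by
  rcases eq_or_ne j i with rfl | hji
  · exact isClosedInDirection_compress_self j A
  intro x hx
  obtain ⟨k, hxk, hk⟩ := mem_compress.1 hx
  have coord : ∀ y ∈ lineFiber A i x, y j = x j := by
    intro y hy
    have := congrFun (mem_lineFiber.1 hy).2 j
    simpa [Function.update_of_ne hji] using this
  obtain ⟨y, hy⟩ := Finset.card_pos.1 (by omega : 0 < (lineFiber A i x).card)
  obtain ⟨l, hyl, -⟩ := h y (mem_lineFiber.1 hy).1
  refine ⟨l, (coord y hy).symm.trans hyl, fun m hm => mem_compress.2 ⟨k, ?_, ?_⟩⟩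
  · rw [Function.update_of_ne hji.symm, hxk]
  · refine hk.trans_le ?_
    -- All points of the fiber share the coordinate `x j`, so lowering it to `m` embeds the fiber
    -- through `x` into the fiber through the lowered point.
    refine Finset.card_le_card_of_injOn (fun y => Function.update y j (m : ℚ)) ?_ ?_
    · intro y' hy'
      obtain ⟨hy1, hy2⟩ := mem_lineFiber.1 hy'
      obtain ⟨l', hl', hcl⟩ := h y' hy1
      have : l' = l := by
        have : (l' : ℚ) = l := by rw [← hl', coord y' hy', ← coord y hy, hyl]
        exact_mod_cast this
      refine mem_lineFiber.2 ⟨hcl m (by omega), ?_⟩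
      rw [Function.update_comm hji, hy2, Function.update_comm hji]
    · intro y1 h1 y2 h2 h12
      have e := congrArg (fun f => Function.update f j (x j)) h12
      simp only [Function.update_idem] at e
      rw [← coord y1 h1, Function.update_eq_self, coord y1 h1, ← coord y2 h2,
        Function.update_eq_self] at e
      exact e

/-! ### Iterated compression and reduction to lower sets -/

/-- The successive compressions in directions `n - 1, …, 0`. -/
noncomputable def compressAll : ℕ → Finset (ℕ → ℚ) → Finset (ℕ → ℚ)
  | 0, A => A
  | n + 1, A => compressAll n (compress n A)

lemma card_compressAll (n : ℕ) (A : Finset (ℕ → ℚ)) : (compressAll n A).card = A.card := by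
  induction n generalizing A with
  | zero => rfl
  | succ n ih => rw [compressAll, ih, card_compress]

lemma compressAll_mono (n : ℕ) {A B : Finset (ℕ → ℚ)} (h : A ⊆ B) :
    compressAll n A ⊆ compressAll n B := by
  induction n generalizing A B with
  | zero => exact h
  | succ n ih => exact ih (compress_mono n h)

open Classical in
lemma compressAll_add_subset (n : ℕ) (A B : Finset (ℕ → ℚ)) :
    compressAll n A + compressAll n B ⊆ compressAll n (A + B) := by
  induction n generalizing A B with
  | zero => exact subset_rfl
  | succ n ih => exact (ih _ _).trans (compressAll_mono n (compress_add_subset n A B))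

-- The extra direction costs nothing: direction 0 is compressed last, and coordinate 0 vanishes on
-- shifted sequences.
open Classical in
lemma image_shiftRight_compressAll (n : ℕ) (A : Finset (ℕ → ℚ)) :
    (compressAll n A).image shiftRight = compressAll (n + 1) (A.image shiftRight) := by
  induction n generalizing A with
  | zero =>
    refine (compress_eq_self fun x hx => ?_).symm
    obtain ⟨y, -, rfl⟩ := Finset.mem_image.1 hx
    rfl
  | succ n ih => rw [compressAll, ih, compressAll, compressAll, image_shiftRight_compress,
      ← compressAll]

lemma IsClosedInDirection.compressAll {j : ℕ} {A : Finset (ℕ → ℚ)}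
    (h : IsClosedInDirection j A) (n : ℕ) : IsClosedInDirection j (compressAll n A) := by
  induction n generalizing A with
  | zero => exact h
  | succ n ih => exact ih (h.compress n)

lemma isClosedInDirection_compressAll {j n : ℕ} (hj : j < n) (A : Finset (ℕ → ℚ)) :
    IsClosedInDirection j (compressAll n A) := by
  induction n generalizing A with
  | zero => omega
  | succ n ih =>
    rcases Nat.lt_succ_iff_lt_or_eq.1 hj with h | rfl
    · exact ih h _
    · exact (isClosedInDirection_compress_self j A).compressAll j

lemma compressAll_supported {d n : ℕ} (hn : n ≤ d) {A : Finset (ℕ → ℚ)}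
    (h : ∀ x ∈ A, ∀ k, d ≤ k → x k = 0) : ∀ x ∈ compressAll n A, ∀ k, d ≤ k → x k = 0 := by
  induction n generalizing A with
  | zero => exact h
  | succ n ih => exact ih (by omega) (compress_supported (by omega) h)

-- The set and its shift must undergo the same operation, so `d + 1` directions are used. On `A`
-- direction `d` is idle; on the shift direction 0 is.
open Classical in
lemma card_compressAll_add_shiftRight_le {A : Finset (ℕ → ℚ)} {d : ℕ}
    (h : ∀ x ∈ A, ∀ k, d ≤ k → x k = 0) :
    (compressAll d A + (compressAll d A).image shiftRight).card
      ≤ (A + A.image shiftRight).card := by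
  rw [← card_compressAll (d + 1) (A + A.image shiftRight)]
  refine Finset.card_le_card (Finset.Subset.trans ?_ (compressAll_add_subset _ _ _))
  have hA : compressAll (d + 1) A = compressAll d A := by
    rw [compressAll, compress_eq_self fun x hx => h x hx d le_rfl]
  rw [image_shiftRight_compressAll, hA]

open Classical in
/-- Replacement of a finite set of rational sequences by a lower set of natural sequences. -/
theorem exists_isLowerSet_card_add_shiftRight_le (A : Finset (ℕ → ℚ)) (d : ℕ)
    (h : ∀ x ∈ A, ∀ k, d ≤ k → x k = 0) :
    ∃ B : Finset (ℕ → ℕ), IsLowerSet (B : Set (ℕ → ℕ)) ∧ (∀ x ∈ B, ∀ k, d ≤ k → x k = 0) ∧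
      B.card = A.card ∧ (B + B.image shiftRight).card ≤ (A + A.image shiftRight).card := by
  set C := compressAll d A with hC
  have hCs : ∀ x ∈ C, ∀ k, d ≤ k → x k = 0 := compressAll_supported le_rfl h
  let φ : (ℕ → ℕ) →+ (ℕ → ℚ) := (Nat.castAddMonoidHom ℚ).compLeft ℕ
  have hφ : ∀ x k, φ x k = (x k : ℚ) := fun x k => rfl
  have hφi : Function.Injective φ := fun x y hxy => by
    funext k
    have := congrFun hxy k
    rw [hφ, hφ] at this
    exact_mod_cast this
  have hφs : ∀ x, shiftRight (φ x) = φ (shiftRight x) := by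
    intro x
    funext k
    cases k <;> simp [hφ]
  have hnat : ∀ z ∈ C, ∃ x, φ x = z := by
    intro z hz
    have : ∀ k, ∃ m : ℕ, z k = m := by
      intro k
      rcases lt_or_ge k d with hk | hk
      · obtain ⟨m, hm, -⟩ := isClosedInDirection_compressAll hk A z hz
        exact ⟨m, hm⟩
      · exact ⟨0, by simp [hCs z hz k hk]⟩
    choose x hx using this
    exact ⟨x, by funext k; simp [hφ, hx]⟩
  set B := C.preimage φ hφi.injOn with hB
  have hBC : B.image φ = C := by
    rw [hB, Finset.image_preimage, Finset.filter_true_of_mem]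
    intro z hz
    exact hnat z hz
  have hmem : ∀ x, x ∈ B ↔ φ x ∈ C := fun x => Finset.mem_preimage
  refine ⟨B, ?_, ?_, ?_, ?_⟩
  · intro x y hyx hx
    -- Passage from `x` down to `y` one coordinate at a time, since closure is known only in single
    -- directions.
    have key : ∀ n, (fun k => if k < n then y k else x k) ∈ B := by
      intro n
      induction n with
      | zero => simpa using hx
      | succ n ih =>
        rcases lt_or_ge n d with hn | hn
        · obtain ⟨k, hk, hcl⟩ := isClosedInDirection_compressAll hn A _ ((hmem _).1 ih)
          have hk' : x n = k := by
            rw [hφ] at hk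
            simpa using hk
          have := hcl (y n) (hk' ▸ hyx n)
          rw [hmem]
          convert this using 1
          funext m
          rcases eq_or_ne m n with rfl | hm
          · simp [hφ]
          · rw [Function.update_of_ne hm, hφ, hφ]
            congr 1
            have : m < n + 1 ↔ m < n := by omega
            simp [this]
        · convert ih using 1
          funext m
          rcases eq_or_ne m n with rfl | hm
          · have : x m = 0 := by
              have := hCs _ ((hmem x).1 hx) m hn
              rw [hφ] at this
              exact_mod_cast this
            have h2 : y m ≤ x m := hyx m
            simp only [lt_add_iff_pos_right, Nat.lt_one_iff, pos_of_gt, lt_irrefl, if_true, if_false]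
            omega
          · have : m < n + 1 ↔ m < n := by omega
            simp [this]
    have hy := key d
    have : (fun k => if k < d then y k else x k) = y := by
      funext k
      rcases lt_or_ge k d with hk | hk
      · simp [hk]
      · have : x k = 0 := by
          have := hCs _ ((hmem x).1 hx) k hk
          rw [hφ] at this
          exact_mod_cast this
        have h2 : y k ≤ x k := hyx k
        simp only [not_lt.2 hk, if_false]
        omega
    rwa [this] at hy
  · intro x hx k hk
    have := hCs _ ((hmem x).1 hx) k hk
    rw [hφ] at this
    exact_mod_cast this
  · rw [← card_compressAll d A, ← hC, ← hBC, Finset.card_image_of_injective _ hφi]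
  · refine le_trans (le_of_eq ?_) (card_compressAll_add_shiftRight_le h)
    rw [← hC, ← hBC, Finset.image_image, ← Finset.card_image_of_injective _ hφi, Finset.image_add,
      Finset.image_image]
    congr 3
    funext x
    exact (hφs x).symm

/-! ### From reals with a transcendental dilate to sequences with the shift -/

open Polynomial in
open Classical in
/-- A finite set of reals is modelled by a finite set of rational sequences, with multiplication
by a transcendental number modelled by the shift. -/
theorem exists_sequences_card_add_shiftRight_le (A : Finset ℝ) {α : ℝ} (hα : Transcendental ℚ α) :
    ∃ (C : Finset (ℕ → ℚ)) (d : ℕ), (∀ x ∈ C, ∀ k, d ≤ k → x k = 0) ∧ C.card = A.card ∧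
      (C + C.image shiftRight).card ≤ (A + α • A).card := by
  let K := FractionRing ℚ[X]
  have hinj : Function.Injective (aeval α : ℚ[X] →ₐ[ℚ] ℝ).toRingHom :=
    transcendental_iff_injective.1 hα
  let ψ : K →+* ℝ := IsFractionRing.lift hinj
  have hψ : ∀ p : ℚ[X], ψ (algebraMap ℚ[X] K p) = aeval α p :=
    fun p => IsFractionRing.lift_algebraMap hinj p
  let _ : Module K ℝ := Module.compHom ℝ ψ
  have hsmul : ∀ (k : K) (x : ℝ), k • x = ψ k * x := fun k x => rfl
  let I := {v : A × A // v.1 ≠ v.2}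
  -- A functional killing none of the finitely many nonzero differences is injective on `A`.
  obtain ⟨f, hf⟩ := Module.exists_dual_forall_apply_ne_zero (K := K) (M := ℝ)
    (fun v : I => (v.1.1 : ℝ) - v.1.2) (fun v => sub_ne_zero.2 fun h => v.2 (Subtype.ext h))
  have hfX : ∀ x, f (α * x) = algebraMap ℚ[X] K X * f x := by
    intro x
    have : α * x = (algebraMap ℚ[X] K X) • x := by rw [hsmul, hψ, aeval_X]
    rw [this, map_smul, smul_eq_mul]
  obtain ⟨b, hb⟩ := IsLocalization.exist_integer_multiples_of_finset (nonZeroDivisors ℚ[X])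
    (A.image f)
  have hint : ∀ a : ℝ, ∃ p : ℚ[X], a ∈ A → algebraMap ℚ[X] K p = (b : ℚ[X]) • f a := by
    intro a
    by_cases ha : a ∈ A
    · obtain ⟨p, hp⟩ := hb (f a) (Finset.mem_image_of_mem f ha)
      exact ⟨p, fun _ => hp⟩
    · exact ⟨0, fun h => absurd h ha⟩
  choose P hP using hint
  have hb0 : algebraMap ℚ[X] K b ≠ 0 := IsFractionRing.to_map_ne_zero_of_mem_nonZeroDivisors b.2
  have hPinj : Set.InjOn (fun a => (P a).coeff) A := by
    intro a ha a' ha' h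
    by_contra hne
    refine hf ⟨(⟨a, ha⟩, ⟨a', ha'⟩), fun h => hne (congrArg Subtype.val h)⟩ ?_
    have e : P a = P a' := Polynomial.coeff_injective h
    have h2 := (hP a ha).symm.trans ((congrArg _ e).trans (hP a' ha'))
    rw [Algebra.smul_def, Algebra.smul_def] at h2
    rw [map_sub, mul_left_cancel₀ hb0 h2, sub_self]
  -- `h` reads off the coefficients of `b • f z`; the junk value of `invFun` for non-polynomials is
  -- never reached. It may merge points of `A + α • A`, which is harmless as only an upper bound is
  -- needed.
  let h : ℝ → ℕ → ℚ := fun z =>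
    (Function.invFun (algebraMap ℚ[X] K) ((b : ℚ[X]) • f z)).coeff
  have hh : ∀ z p, algebraMap ℚ[X] K p = (b : ℚ[X]) • f z → h z = p.coeff := by
    intro z p hp
    simp only [h]
    rw [← hp, Function.leftInverse_invFun (IsFractionRing.injective ℚ[X] K) p]
  refine ⟨A.image fun a => (P a).coeff, A.sup (fun a => (P a).natDegree) + 1, ?_,
    Finset.card_image_of_injOn hPinj, ?_⟩
  · intro x hx k hk
    obtain ⟨a, ha, rfl⟩ := Finset.mem_image.1 hx
    refine Polynomial.coeff_eq_zero_of_natDegree_lt ?_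
    have := Finset.le_sup (f := fun a => (P a).natDegree) ha
    exact Nat.lt_of_lt_of_le (Nat.lt_succ_of_le this) hk
  · refine le_trans (Finset.card_le_card ?_) (Finset.card_image_le (f := h))
    intro z hz
    obtain ⟨x, hx, y, hy, rfl⟩ := Finset.mem_add.1 hz
    obtain ⟨y', hy', rfl⟩ := Finset.mem_image.1 hy
    obtain ⟨a, ha, rfl⟩ := Finset.mem_image.1 hx
    obtain ⟨a', ha', rfl⟩ := Finset.mem_image.1 hy'
    refine Finset.mem_image.2 ⟨a + α • a',
      Finset.add_mem_add ha (Finset.smul_mem_smul_finset ha'), ?_⟩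
    rw [hh _ (P a + X * P a')]
    · funext k
      cases k with
      | zero => simp
      | succ k => simp [coeff_X_mul]
    · rw [map_add, map_mul, hP a ha, hP a' ha', smul_eq_mul, map_add, hfX, smul_add,
        mul_smul_comm]


/-! ### Lower sets: truncation to a small box -/

open Classical in
/-- Coordinates of points of a lower set are large only rarely, in terms of the size of
the sum with the shift. -/
lemma card_filter_eq_mul_sq_le {A : Finset (ℕ → ℕ)} (hA : IsLowerSet (A : Set (ℕ → ℕ)))
    (i m : ℕ) :
    (A.filter fun x => x i = m).card * (m + 1) ^ 2 ≤ (A + A.image shiftRight).card := by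
  have : (A.filter fun x => x i = m).card * (m + 1) ^ 2 =
      ((A.filter fun x => x i = m) ×ˢ (Finset.range (m + 1) ×ˢ Finset.range (m + 1))).card := by
    rw [Finset.card_product, Finset.card_product, Finset.card_range, sq]
  rw [this]
  -- The point is cut at `i`. After the upper part is shifted, `a` sits at `i`, `b` at `i + 1`, and
  -- the two parts do not overlap, so everything can be recovered.
  let lo : (ℕ → ℕ) → ℕ → ℕ → ℕ := fun x a k => if k < i then x k else if k = i then a else 0
  let hi : (ℕ → ℕ) → ℕ → ℕ → ℕ := fun x b k => if k < i then 0 else if k = i then b else x k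
  refine Finset.card_le_card_of_injOn
    (fun q => lo q.1 q.2.1 + shiftRight (hi q.1 q.2.2)) ?_ ?_
  · rintro ⟨x, a, b⟩ hq
    simp only [Finset.coe_product, Set.mem_prod, Finset.mem_coe, Finset.mem_filter,
      Finset.mem_range] at hq
    obtain ⟨⟨hx, hxi⟩, ha, hb⟩ := hq
    refine Finset.add_mem_add (hA (a := x) ?_ hx) (Finset.mem_image_of_mem _ (hA (a := x) ?_ hx))
    · intro k
      simp only [lo]
      split_ifs with h1 h2
      · exact le_rfl
      · subst h2; omega
      · exact Nat.zero_le _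
    · intro k
      simp only [hi]
      split_ifs with h1 h2
      · exact Nat.zero_le _
      · subst h2; omega
      · exact le_rfl
  · rintro ⟨x, a, b⟩ hq ⟨x', a', b'⟩ hq' h
    simp only [Finset.coe_product, Set.mem_prod, Finset.mem_coe, Finset.mem_filter,
      Finset.mem_range] at hq hq'
    have hlow : ∀ (y : ℕ → ℕ) (c k : ℕ), k ≤ i → shiftRight (hi y c) k = 0 := by
      intro y c k hk
      cases k with
      | zero => rfl
      | succ k => simp [hi, show k < i by omega]
    have hlt : ∀ k, k < i → x k = x' k := by
      intro k hk
      have := congrFun h k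
      simp only [Pi.add_apply, hlow _ _ k hk.le] at this
      simpa [lo, hk] using this
    have ha : a = a' := by
      have := congrFun h i
      simp only [Pi.add_apply, hlow _ _ i le_rfl] at this
      simpa [lo] using this
    have hb : b = b' := by
      have := congrFun h (i + 1)
      simpa [lo, hi] using this
    have hgt : ∀ k, i < k → x k = x' k := by
      intro k hk
      have := congrFun h (k + 1)
      simpa [lo, hi, show ¬ k + 1 < i by omega, show k + 1 ≠ i by omega,
        show ¬ k < i by omega, show k ≠ i by omega] using this
    have hx : x = x' := by
      funext k
      rcases lt_trichotomy k i with hk | rfl | hk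
      · exact hlt k hk
      · rw [hq.1.2, hq'.1.2]
      · exact hgt k hk
    rw [hx, ha, hb]

open Classical in
/-- The number of nonzero coordinates of a point of a lower set is logarithmic. -/
lemma two_pow_card_support_le {A : Finset (ℕ → ℕ)} (hA : IsLowerSet (A : Set (ℕ → ℕ)))
    {x : ℕ → ℕ} (hx : x ∈ A) (d : ℕ) :
    2 ^ ((Finset.range d).filter fun k => x k ≠ 0).card ≤ A.card := by
  rw [← Finset.card_powerset]
  -- Erasing any part of the support stays in the lower set.
  refine Finset.card_le_card_of_injOn (fun T k => if k ∈ T then x k else 0) ?_ ?_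
  · intro T _
    refine hA (a := x) (fun k => ?_) hx
    dsimp only
    split_ifs
    · exact le_rfl
    · exact Nat.zero_le _
  · intro T hT T' hT' h
    have hmem : ∀ U ∈ ((Finset.range d).filter fun k => x k ≠ 0).powerset, ∀ k,
        k ∈ U ↔ (if k ∈ U then x k else 0) ≠ 0 := by
      intro U hU k
      constructor
      · intro hk
        have := (Finset.mem_filter.1 (Finset.mem_powerset.1 hU hk)).2
        simpa [hk] using this
      · intro hk
        by_contra hne
        simp [hne] at hk
    ext k
    rw [hmem T hT k, hmem T' hT' k]
    rw [show (if k ∈ T then x k else 0) = if k ∈ T' then x k else 0 from congrFun h k]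

open Classical in
/-- The number of nontrivial coordinates of a lower set, in terms of the size of the sum with
the shift. -/
lemma card_coordinates_mul_card_le {A : Finset (ℕ → ℕ)} (hA : IsLowerSet (A : Set (ℕ → ℕ)))
    {d : ℕ} (hd : ∀ x ∈ A, ∀ k, d ≤ k → x k = 0) :
    ((Finset.range d).filter fun i => ∃ x ∈ A, x i ≠ 0).card * A.card
      ≤ (Nat.log 2 A.card + 1) * (A + A.image shiftRight).card := by
  set D := (Finset.range d).filter fun i => ∃ x ∈ A, x i ≠ 0 with hD
  let e : ℕ → ℕ → ℕ := fun i => Pi.single i 1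
  let f : ℕ × (ℕ → ℕ) → ℕ → ℕ := fun q => e q.1 + shiftRight q.2
  have hf : ∀ q ∈ D ×ˢ A, f q ∈ A + A.image shiftRight := by
    rintro ⟨i, y⟩ hq
    obtain ⟨hi, hy⟩ := Finset.mem_product.1 hq
    obtain ⟨-, x, hx, hxi⟩ := Finset.mem_filter.1 hi
    refine Finset.add_mem_add (hA (a := x) (fun k => ?_) hx) (Finset.mem_image_of_mem _ hy)
    rcases eq_or_ne k i with rfl | hk
    · simp only [e, Pi.single_eq_same]
      dsimp only at hxi
      omega
    · simp [e, hk]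
  rw [← Finset.card_product]
  refine Finset.card_le_mul_card_image_of_maps_to hf _ fun z hz => ?_
  rcases ((D ×ˢ A).filter fun q => f q = z).eq_empty_or_nonempty with h0 | ⟨⟨i₀, y₀⟩, h0⟩
  · rw [h0]; simp
  obtain ⟨h1, h2⟩ := Finset.mem_filter.1 h0
  have hy₀ := (Finset.mem_product.1 h1).2
  set T := (Finset.range d).filter fun k => y₀ k ≠ 0 with hT
  have hTlog : T.card ≤ Nat.log 2 A.card := by
    refine Nat.le_log_of_pow_le (by norm_num) ?_
    exact two_pow_card_support_le hA hy₀ d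
  -- In another representation of `z`, the index `i` satisfies `z i ≠ 0`, so it is `i₀` or a
  -- successor of an element of the support of `y₀`; and `i` determines `y`.
  refine le_trans (b := (insert i₀ (T.image Nat.succ)).card) ?_ ?_
  · refine Finset.card_le_card_of_injOn Prod.fst ?_ ?_
    · rintro ⟨i, y⟩ hq
      obtain ⟨hq1, hq2⟩ := Finset.mem_filter.1 hq
      have hval : e i + shiftRight y = e i₀ + shiftRight y₀ := hq2.trans h2.symm
      by_contra hni
      simp only [Finset.coe_insert, Set.mem_insert_iff, not_or, Finset.mem_coe,
        Finset.mem_image, not_exists, not_and] at hni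
      have := congrFun hval i
      simp only [Pi.add_apply, e, Pi.single_eq_same, Pi.single_eq_of_ne hni.1, zero_add] at this
      cases i with
      | zero => simp at this
      | succ i =>
        rw [shiftRight_succ, shiftRight_succ] at this
        refine hni.2 i ?_ rfl
        rw [hT, Finset.mem_filter, Finset.mem_range]
        refine ⟨?_, by omega⟩
        by_contra hid
        have := hd y₀ hy₀ i (by omega)
        omega
    · rintro ⟨i, y⟩ hq ⟨i', y'⟩ hq' hii
      dsimp only at hii
      subst hii
      have := (Finset.mem_filter.1 hq).2.trans (Finset.mem_filter.1 hq').2.symm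
      exact congrArg (Prod.mk i) (shiftRight_injective (add_left_cancel this))
  · refine (Finset.card_insert_le _ _).trans ?_
    have := Finset.card_image_le (s := T) (f := Nat.succ)
    omega

/-- Telescoping, from 1/(m+1)² ≤ 1/m - 1/(m+1). -/
lemma sum_Ico_one_div_sq_le {a b : ℕ} (ha : 0 < a) (hab : a ≤ b) :
    ∑ m ∈ Finset.Ico a b, 1 / ((m : ℝ) + 1) ^ 2 ≤ 1 / (a : ℝ) - 1 / b := by
  induction b, hab using Nat.le_induction with
  | base => simp
  | succ n hn ih =>
    rw [Finset.sum_Ico_succ_top hn]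
    have hn0 : (0 : ℝ) < n := by exact_mod_cast ha.trans_le hn
    have : 1 / ((n : ℝ) + 1) ^ 2 ≤ 1 / n - 1 / (n + 1) := by
      rw [div_sub_div _ _ hn0.ne' (by positivity), div_le_div_iff₀ (by positivity) (by positivity)]
      nlinarith
    push_cast
    linarith

open Classical in
/-- Few points of a lower set have a large coordinate. -/
lemma card_filter_ge_le {A : Finset (ℕ → ℕ)} (hA : IsLowerSet (A : Set (ℕ → ℕ)))
    (i : ℕ) {M : ℕ} (hM : 0 < M) :
    ((A.filter fun x => M ≤ x i).card : ℝ) ≤ (A + A.image shiftRight).card / M := by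
  set N := (A + A.image shiftRight).card with hN
  set b := M + A.sup (fun x => x i) + 1 with hb
  have hmaps : ∀ x ∈ A.filter (fun x => M ≤ x i), x i ∈ Finset.Ico M b := by
    intro x hx
    obtain ⟨hxA, hxM⟩ := Finset.mem_filter.1 hx
    have : x i ≤ A.sup (fun x => x i) := Finset.le_sup (f := fun x : ℕ → ℕ => x i) hxA
    exact Finset.mem_Ico.2 ⟨hxM, by omega⟩
  rw [Finset.card_eq_sum_card_fiberwise hmaps]
  push_cast
  calc ∑ m ∈ Finset.Ico M b, (((A.filter fun x => M ≤ x i).filter fun x => x i = m).card : ℝ)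
      ≤ ∑ m ∈ Finset.Ico M b, (N : ℝ) * (1 / ((m : ℝ) + 1) ^ 2) := by
        refine Finset.sum_le_sum fun m _ => ?_
        rw [mul_one_div, le_div_iff₀ (by positivity)]
        have h1 := card_filter_eq_mul_sq_le hA i m
        have h2 : ((A.filter fun x => M ≤ x i).filter fun x => x i = m).card
            ≤ (A.filter fun x => x i = m).card :=
          Finset.card_le_card (Finset.filter_subset_filter _ (Finset.filter_subset _ _))
        have h3 := (Nat.mul_le_mul_right ((m + 1) ^ 2) h2).trans h1
        exact_mod_cast h3
    _ ≤ N * (1 / M - 1 / b) := by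
        rw [← Finset.mul_sum]
        gcongr
        exact sum_Ico_one_div_sq_le hM (by omega)
    _ ≤ N / M := by
        rw [mul_sub, mul_one_div]
        have : 0 ≤ (N : ℝ) * (1 / b) := by positivity
        linarith

open Classical in
/-- Truncation of a lower set to a box keeps half of the points. -/
lemma card_le_two_mul_card_truncation {A : Finset (ℕ → ℕ)}
    (hA : IsLowerSet (A : Set (ℕ → ℕ))) {d : ℕ} (hd : ∀ x ∈ A, ∀ k, d ≤ k → x k = 0) {M : ℕ}
    (hM : 0 < M)
    (h : 2 * ((Nat.log 2 A.card + 1 : ℕ) : ℝ) * ((A + A.image shiftRight).card : ℝ) ^ 2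
      ≤ M * (A.card : ℝ) ^ 2) :
    (A.card : ℝ) ≤ 2 * (A.filter fun x => ∀ i, x i < M).card := by
  rcases Nat.eq_zero_or_pos A.card with h0 | hApos
  · rw [h0]; simp
  have hn : (0 : ℝ) < A.card := by exact_mod_cast hApos
  have hM' : (0 : ℝ) < M := by exact_mod_cast hM
  set D := (Finset.range d).filter fun i => ∃ x ∈ A, x i ≠ 0 with hD
  set N := (A + A.image shiftRight).card with hN
  have hcover : (A.filter fun x => ¬ ∀ i, x i < M) ⊆
      D.biUnion fun i => A.filter fun x => M ≤ x i := by
    intro x hx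
    obtain ⟨hxA, hxM⟩ := Finset.mem_filter.1 hx
    push Not at hxM
    obtain ⟨i, hi⟩ := hxM
    refine Finset.mem_biUnion.2 ⟨i, Finset.mem_filter.2 ⟨?_, x, hxA, by omega⟩,
      Finset.mem_filter.2 ⟨hxA, hi⟩⟩
    rw [Finset.mem_range]
    by_contra hid
    have := hd x hxA i (by omega)
    omega
  -- Union bound over the active coordinates only, so the dimension `d` does not enter.
  have h1 : ((A.filter fun x => ¬ ∀ i, x i < M).card : ℝ) ≤ D.card * (N / M) := by
    have h2 := (Finset.card_le_card hcover).trans Finset.card_biUnion_le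
    calc ((A.filter fun x => ¬ ∀ i, x i < M).card : ℝ)
        ≤ ∑ i ∈ D, ((A.filter fun x => M ≤ x i).card : ℝ) := by exact_mod_cast h2
      _ ≤ ∑ i ∈ D, (N : ℝ) / M := Finset.sum_le_sum fun i _ => card_filter_ge_le hA i hM
      _ = _ := by rw [Finset.sum_const, nsmul_eq_mul]
  have h3 : (D.card : ℝ) * A.card ≤ ((Nat.log 2 A.card + 1 : ℕ) : ℝ) * N := by
    exact_mod_cast card_coordinates_mul_card_le hA hd
  have h4 : (D.card : ℝ) * (N / M) ≤ A.card / 2 := by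
    rw [← mul_div_assoc, div_le_div_iff₀ hM' (by norm_num)]
    refine le_of_mul_le_mul_right ?_ hn
    calc (D.card : ℝ) * N * 2 * A.card = 2 * N * (D.card * A.card) := by ring
      _ ≤ 2 * N * (((Nat.log 2 A.card + 1 : ℕ) : ℝ) * N) := by gcongr
      _ = 2 * ((Nat.log 2 A.card + 1 : ℕ) : ℝ) * (N : ℝ) ^ 2 := by ring
      _ ≤ M * (A.card : ℝ) ^ 2 := h
      _ = A.card * M * A.card := by ring
  have h5 : ((A.filter fun x => ∀ i, x i < M).card : ℝ) +
      (A.filter fun x => ¬ ∀ i, x i < M).card = A.card := by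
    exact_mod_cast Finset.card_filter_add_card_filter_not (s := A) (fun x => ∀ i, x i < M)
  linarith


/-! ### The one-dimensional inequality -/

/-- One-dimensional Prékopa–Leindler type inequality with squares. -/
lemma sum_sq_add_sum_sq_le (u v w : ℕ → ℝ) (hu0 : u 0 = 1) (hv0 : v 0 = 1)
    (hu : ∀ s, 0 ≤ u s) (hv : ∀ s, 0 ≤ v s) (hu1 : ∀ s, u s ≤ 1) (hv1 : ∀ s, v s ≤ 1)
    (hw : ∀ s t, u s * v t ≤ w (s + t)) (a b : ℕ) :
    ∑ s ∈ Finset.range (a + 1), u s ^ 2 + ∑ t ∈ Finset.range (b + 1), v t ^ 2 - 1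
      ≤ ∑ r ∈ Finset.range (a + b + 1), w r := by
  induction h : a + b generalizing a b with
  | zero =>
    obtain ⟨rfl, rfl⟩ : a = 0 ∧ b = 0 := by omega
    have := hw 0 0
    simp [hu0, hv0] at this ⊢
    exact this
  | succ k ih =>
    rw [Finset.sum_range_succ w (k + 1)]
    have hab := hw a b
    rw [h] at hab
    -- The smaller of the two last terms is dropped: its square is at most `u a * v b`, hence at
    -- most the last term of `w`.
    have removeLeft : ∀ a', a = a' + 1 → u a ≤ v b →
        ∑ s ∈ Finset.range (a + 1), u s ^ 2 + ∑ t ∈ Finset.range (b + 1), v t ^ 2 - 1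
          ≤ ∑ r ∈ Finset.range (k + 1), w r + w (k + 1) := by
      intro a' ha' hle
      have := ih a' b (by omega)
      rw [ha'] at hle hab ⊢
      rw [Finset.sum_range_succ _ (a' + 1)]
      nlinarith [hu (a' + 1)]
    have removeRight : ∀ b', b = b' + 1 → v b ≤ u a →
        ∑ s ∈ Finset.range (a + 1), u s ^ 2 + ∑ t ∈ Finset.range (b + 1), v t ^ 2 - 1
          ≤ ∑ r ∈ Finset.range (k + 1), w r + w (k + 1) := by
      intro b' hb' hle
      have := ih a b' (by omega)
      rw [hb'] at hle hab ⊢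
      rw [Finset.sum_range_succ _ (b' + 1)]
      nlinarith [hv (b' + 1)]
    rcases Nat.eq_zero_or_pos a with rfl | ha
    · exact removeRight (b - 1) (by omega) (by rw [hu0]; exact hv1 b)
    rcases Nat.eq_zero_or_pos b with rfl | hb
    · exact removeLeft (a - 1) (by omega) (by rw [hv0]; exact hu1 a)
    rcases le_total (u a) (v b) with hle | hle
    · exact removeLeft (a - 1) (by omega) hle
    · exact removeRight (b - 1) (by omega) hle

lemma rpow_half_sq {x ε : ℝ} (hx : 0 ≤ x) : (x ^ ((1 + ε) / 2)) ^ 2 = x ^ (1 + ε) := by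
  rw [← Real.rpow_natCast, ← Real.rpow_mul hx]
  norm_num

/-- For sequences in `[0,1]` of small total mass, exponents below `1` gain a constant factor. -/
lemma rpow_one_add_sum_le_sum_rpow_half {ε : ℝ} (hε : 0 < ε) (hε1 : ε ≤ 1 / 25)
    (x : ℕ → ℝ) (M : ℕ) (hx : ∀ s, 0 ≤ x s)
    (hX : ∑ s ∈ Finset.range M, x s ≤ 1 / 2) :
    (1 + ∑ s ∈ Finset.range M, x s) ^ (1 + ε)
      ≤ 1 + ∑ s ∈ Finset.range M, x s ^ ((1 + ε) / 2) := by
  set X := ∑ s ∈ Finset.range M, x s with hXdef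
  have hX0 : 0 ≤ X := Finset.sum_nonneg fun s _ => hx s
  -- The exponent is at most 3/4, and (1/2)^(1/4) ≤ 10/11. The gain 1.1 beats the loss from `(1 + X)
  -- ^ ε`.
  have key : ∀ s ∈ Finset.range M, 1.1 * x s ≤ x s ^ ((1 + ε) / 2) := by
    intro s hs
    have hs2 : x s ≤ 1 / 2 := (Finset.single_le_sum (fun i _ => hx i) hs).trans hX
    rcases (hx s).eq_or_lt with h0 | h0
    · rw [← h0]; simpa using Real.rpow_nonneg le_rfl _
    have e1 : x s ^ (3 / 4 : ℝ) ≤ x s ^ ((1 + ε) / 2) :=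
      Real.rpow_le_rpow_of_exponent_ge h0 (by linarith) (by linarith)
    have e2 : x s = x s ^ (3 / 4 : ℝ) * x s ^ (1 / 4 : ℝ) := by
      rw [← Real.rpow_add h0]; norm_num
    have e3 : x s ^ (1 / 4 : ℝ) ≤ 10 / 11 := by
      have h4 : (x s ^ (1 / 4 : ℝ)) ^ 4 ≤ (10 / 11 : ℝ) ^ 4 := by
        rw [← Real.rpow_natCast, ← Real.rpow_mul h0.le]
        norm_num
        linarith
      exact le_of_pow_le_pow_left₀ (by norm_num) (by norm_num) h4
    have e4 := mul_le_mul_of_nonneg_left e3 (Real.rpow_nonneg h0.le (3 / 4 : ℝ))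
    rw [← e2] at e4
    linarith
  have h1 : 1.1 * X ≤ ∑ s ∈ Finset.range M, x s ^ ((1 + ε) / 2) := by
    rw [hXdef, Finset.mul_sum]; exact Finset.sum_le_sum key
  have h2 : (1 + X) ^ ε ≤ 1 + ε * X :=
    rpow_one_add_le_one_add_mul_self (by linarith) hε.le (by linarith)
  rw [Real.rpow_add (by linarith), Real.rpow_one]
  nlinarith [mul_le_mul_of_nonneg_left h2 (by linarith : 0 ≤ 1 + X), mul_nonneg hX0 hX0]

/-- Terms below 1/(100M) contribute at most 1/100 in total; the others lose at most the factor
(100M)^(-ε) ≥ 0.95. -/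
lemma sum_rpow_one_add_ge {ε : ℝ} (hε : 0 < ε) (x : ℕ → ℝ) (M : ℕ) (hM : 0 < M)
    (hMε : (100 * (M : ℝ)) ^ ε ≤ 1.05) (hx : ∀ s, 0 ≤ x s) :
    0.95 * (∑ s ∈ Finset.range M, x s - 1 / 100) ≤ ∑ s ∈ Finset.range M, x s ^ (1 + ε) := by
  have hM' : (0 : ℝ) < M := by exact_mod_cast hM
  have key : ∀ s ∈ Finset.range M, 0.95 * (x s - 1 / (100 * M)) ≤ x s ^ (1 + ε) := by
    intro s _
    rcases le_or_gt (x s) (1 / (100 * M)) with h | h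
    · exact le_trans (by nlinarith) (Real.rpow_nonneg (hx s) _)
    have hpos : 0 < 1 / (100 * (M : ℝ)) := by positivity
    have h0 : 0 < x s := hpos.trans h
    have h1 : (1 / (100 * (M : ℝ))) ^ ε ≤ x s ^ ε := Real.rpow_le_rpow hpos.le h.le hε.le
    have h2 : 0.95 ≤ (1 / (100 * (M : ℝ))) ^ ε := by
      rw [Real.div_rpow (by norm_num) (by positivity), Real.one_rpow,
        le_div_iff₀ (by positivity)]
      nlinarith
    rw [Real.rpow_add h0, Real.rpow_one]
    nlinarith
  calc 0.95 * (∑ s ∈ Finset.range M, x s - 1 / 100)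
      = ∑ s ∈ Finset.range M, 0.95 * (x s - 1 / (100 * M)) := by
        rw [← Finset.mul_sum, Finset.sum_sub_distrib]
        simp
        field_simp
        simp
    _ ≤ _ := Finset.sum_le_sum key

/-- The normalized one-dimensional inequality. -/
lemma rpow_le_sum_of_mul_le {ε : ℝ} (hε : 0 < ε) (hε1 : ε ≤ 1 / 25)
    (x y w : ℕ → ℝ) (M : ℕ)
    (hMε : (100 * ((M + 1 : ℕ) : ℝ)) ^ ε ≤ 1.05) (hx0 : x 0 = 1) (hy0 : y 0 = 1)
    (hx : ∀ s, 0 ≤ x s) (hy : ∀ s, 0 ≤ y s) (hx1 : ∀ s, x s ≤ 1) (hy1 : ∀ s, y s ≤ 1)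
    (hw0 : ∀ r, 0 ≤ w r)
    (hw : ∀ s t, (x s * y t) ^ ((1 + ε) / 2) ≤ w (s + t)) :
    ((∑ s ∈ Finset.range (M + 1), x s) * (∑ s ∈ Finset.range (M + 1), y s)) ^ ((1 + ε) / 2)
      ≤ ∑ r ∈ Finset.range (M + M + 1), w r := by
  set p := (1 + ε) / 2 with hp
  have hppos : 0 < p := by rw [hp]; linarith
  have hM1 : (1 : ℝ) ≤ ((M + 1 : ℕ) : ℝ) := by exact_mod_cast Nat.succ_pos M
  rcases Nat.eq_zero_or_pos M with rfl | hMpos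
  · have := hw 0 0
    simpa [hx0, hy0] using this
  have hMε' : (100 * (M : ℝ)) ^ ε ≤ 1.05 :=
    (Real.rpow_le_rpow (by positivity) (by push_cast; linarith) hε.le).trans hMε
  rw [Finset.sum_range_succ' x, Finset.sum_range_succ' y, hx0, hy0]
  set X := ∑ s ∈ Finset.range M, x (s + 1) with hX
  set Y := ∑ s ∈ Finset.range M, y (s + 1) with hY
  set W := ∑ r ∈ Finset.range (M + M + 1), w r with hW
  have bounds : ∀ z : ℕ → ℝ, (∀ s, 0 ≤ z s) → (∀ s, z s ≤ 1) →
      0 ≤ ∑ s ∈ Finset.range M, z (s + 1) ∧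
      (1 + ∑ s ∈ Finset.range M, z (s + 1)) ^ (1 + ε)
        ≤ 1.05 * (1 + ∑ s ∈ Finset.range M, z (s + 1)) := by
    intro z h0 h1
    have a1 : 0 ≤ ∑ s ∈ Finset.range M, z (s + 1) := Finset.sum_nonneg fun s _ => h0 _
    have a2 : ∑ s ∈ Finset.range M, z (s + 1) ≤ M := by
      simpa using Finset.sum_le_sum (s := Finset.range M) (fun s _ => h1 (s + 1))
    refine ⟨a1, ?_⟩
    rw [Real.rpow_add (by linarith), Real.rpow_one, mul_comm]
    refine mul_le_mul_of_nonneg_right ?_ (by linarith)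
    refine (Real.rpow_le_rpow (by linarith) ?_ hε.le).trans hMε
    push_cast
    linarith
  have sumHalf : ∀ z : ℕ → ℝ, z 0 = 1 → (∀ s, 0 ≤ z s) → (∀ s, z s ^ p ≤ w s) →
      1 + ∑ s ∈ Finset.range M, z (s + 1) ^ p ≤ W := by
    intro z hz0 h0 hzw
    calc 1 + ∑ s ∈ Finset.range M, z (s + 1) ^ p = ∑ s ∈ Finset.range (M + 1), z s ^ p := by
          rw [Finset.sum_range_succ', hz0, Real.one_rpow, add_comm]
      _ ≤ ∑ s ∈ Finset.range (M + 1), w s := Finset.sum_le_sum fun s _ => hzw s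
      _ ≤ W := Finset.sum_le_sum_of_subset_of_nonneg
          (Finset.range_subset_range.2 (by omega)) fun r _ _ => hw0 r
  have halfGe : ∀ z : ℕ → ℝ, (∀ s, 0 ≤ z s) → (∀ s, z s ≤ 1) →
      ∑ s ∈ Finset.range M, z (s + 1) ≤ ∑ s ∈ Finset.range M, z (s + 1) ^ p := by
    intro z h0 h1
    refine Finset.sum_le_sum fun s _ => ?_
    exact Real.self_le_rpow_of_le_one (h0 _) (h1 _) (by rw [hp]; linarith)
  obtain ⟨hX0, hXb⟩ := bounds x hx hx1
  obtain ⟨hY0, hYb⟩ := bounds y hy hy1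
  have hxw : ∀ s, x s ^ p ≤ w s := fun s => by simpa [hy0] using hw s 0
  have hyw : ∀ s, y s ^ p ≤ w s := fun s => by simpa [hx0] using hw 0 s
  have hWx := sumHalf x hx0 hx hxw
  have hWy := sumHalf y hy0 hy hyw
  have hWx' := halfGe x hx hx1
  have hWy' := halfGe y hy hy1
  have hΦx0 : 0 ≤ (1 + X) ^ (1 + ε) := Real.rpow_nonneg (by linarith) _
  have hΦy0 : 0 ≤ (1 + Y) ^ (1 + ε) := Real.rpow_nonneg (by linarith) _
  have hW0 : 0 ≤ W := by linarith
  suffices h : (1 + X) ^ (1 + ε) * (1 + Y) ^ (1 + ε) ≤ W ^ 2 by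
    rw [add_comm X, add_comm Y]
    refine le_of_sq_le_sq ?_ hW0
    rw [rpow_half_sq (by positivity), Real.mul_rpow (by linarith) (by linarith)]
    exact h
  -- Little mass off zero: each sequence alone, paired with the other's term at 0, already bounds
  -- `W`.
  by_cases hsmall : X ≤ 1 / 2 ∧ Y ≤ 1 / 2
  · have h1 := rpow_one_add_sum_le_sum_rpow_half hε hε1 (fun s => x (s + 1)) M
      (fun s => hx _) hsmall.1
    have h2 := rpow_one_add_sum_le_sum_rpow_half hε hε1 (fun s => y (s + 1)) M
      (fun s => hy _) hsmall.2
    rw [sq]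
    exact mul_le_mul (h1.trans hWx) (h2.trans hWy) hΦy0 hW0
  -- Both masses substantial: `W` is nearly 1 + X + Y or more, which exceeds the arithmetic mean of
  -- the two powers; AM–GM concludes.
  by_cases hlarge : 1 / 3 ≤ X ∧ 1 / 3 ≤ Y
  · have h1 := sum_rpow_one_add_ge hε (fun s => x (s + 1)) M hMpos hMε' (fun s => hx _)
    have h2 := sum_rpow_one_add_ge hε (fun s => y (s + 1)) M hMpos hMε' (fun s => hy _)
    have h3 := sum_sq_add_sum_sq_le (fun s => x s ^ p) (fun s => y s ^ p) w
      (by simp [hx0]) (by simp [hy0]) (fun s => Real.rpow_nonneg (hx s) _)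
      (fun s => Real.rpow_nonneg (hy s) _) (fun s => Real.rpow_le_one (hx s) (hx1 s) hppos.le)
      (fun s => Real.rpow_le_one (hy s) (hy1 s) hppos.le)
      (fun s t => by rw [← Real.mul_rpow (hx s) (hy t)]; exact hw s t) M M
    simp only [hp, rpow_half_sq (hx _), rpow_half_sq (hy _)] at h3
    rw [Finset.sum_range_succ', Finset.sum_range_succ' (fun s => y s ^ (1 + ε)), hx0, hy0,
      Real.one_rpow] at h3
    obtain ⟨hX3, hY3⟩ := hlarge
    have h4 : ((1 + X) ^ (1 + ε) + (1 + Y) ^ (1 + ε)) / 2 ≤ W := by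
      simp only [← hX, ← hY, ← hW] at h1 h2 h3
      linarith
    nlinarith [sq_nonneg ((1 + X) ^ (1 + ε) - (1 + Y) ^ (1 + ε))]
  -- Unbalanced masses: the larger sequence suffices, since 1.05² · 4/3 < 3/2 ≤ 1 + b.
  have mixed : ∀ a b fa fb : ℝ, 0 ≤ a → a ≤ 1 / 3 → 1 / 2 ≤ b → 1 + b ≤ W → 0 ≤ fa → 0 ≤ fb →
      fa ≤ 1.05 * (1 + a) → fb ≤ 1.05 * (1 + b) → fa * fb ≤ W ^ 2 := by
    intro a b fa fb ha ha' hb hbW hfa hfb h1 h2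
    calc fa * fb ≤ (1.05 * (4 / 3)) * (1.05 * (1 + b)) :=
          mul_le_mul (by linarith) h2 hfb (by norm_num)
      _ ≤ (1 + b) ^ 2 := by nlinarith
      _ ≤ W ^ 2 := by gcongr
  rcases le_total X (1 / 3) with h | h
  · have : 1 / 2 ≤ Y := by
      by_contra hh
      exact hsmall ⟨by linarith, by linarith⟩
    exact mixed X Y _ _ hX0 h this (by linarith) hΦx0 hΦy0 hXb hYb
  · have hY3 : Y ≤ 1 / 3 := by
      by_contra hh
      exact hlarge ⟨h, by linarith⟩
    have : 1 / 2 ≤ X := by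
      by_contra hh
      exact hsmall ⟨by linarith, by linarith⟩
    rw [mul_comm]
    exact mixed Y X _ _ hY0 hY3 this (by linarith) hΦy0 hΦx0 hYb hXb

/-- One-dimensional inequality for sequences whose first term is maximal. -/
lemma rpow_sum_mul_sum_le_sum {ε : ℝ} (hε : 0 < ε) (hε1 : ε ≤ 1 / 25)
    (x y w : ℕ → ℝ) (M : ℕ)
    (hMε : (100 * ((M + 1 : ℕ) : ℝ)) ^ ε ≤ 1.05)
    (hx : ∀ s, 0 ≤ x s) (hy : ∀ s, 0 ≤ y s) (hx1 : ∀ s, x s ≤ x 0) (hy1 : ∀ s, y s ≤ y 0)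
    (hw0 : ∀ r, 0 ≤ w r)
    (hw : ∀ s t, (x s * y t) ^ ((1 + ε) / 2) ≤ w (s + t)) :
    ((∑ s ∈ Finset.range (M + 1), x s) * (∑ s ∈ Finset.range (M + 1), y s)) ^ ((1 + ε) / 2)
      ≤ ∑ r ∈ Finset.range (M + M + 1), w r := by
  have hp : (1 + ε) / 2 ≠ 0 := by positivity
  have hW : 0 ≤ ∑ r ∈ Finset.range (M + M + 1), w r := Finset.sum_nonneg fun r _ => hw0 r
  rcases (hx 0).eq_or_lt with h0 | hx0
  · have : ∑ s ∈ Finset.range (M + 1), x s = 0 :=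
      Finset.sum_eq_zero fun s _ => le_antisymm (h0 ▸ hx1 s) (hx s)
    rw [this, zero_mul, Real.zero_rpow hp]; exact hW
  rcases (hy 0).eq_or_lt with h0 | hy0
  · have : ∑ s ∈ Finset.range (M + 1), y s = 0 :=
      Finset.sum_eq_zero fun s _ => le_antisymm (h0 ▸ hy1 s) (hy s)
    rw [this, mul_zero, Real.zero_rpow hp]; exact hW
  have hxy : 0 < (x 0 * y 0) ^ ((1 + ε) / 2) := Real.rpow_pos_of_pos (by positivity) _
  have := rpow_le_sum_of_mul_le hε hε1 (fun s => x s / x 0) (fun s => y s / y 0)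
    (fun r => w r / (x 0 * y 0) ^ ((1 + ε) / 2)) M hMε (div_self hx0.ne') (div_self hy0.ne')
    (fun s => div_nonneg (hx s) hx0.le) (fun s => div_nonneg (hy s) hy0.le)
    (fun s => (div_le_one hx0).2 (hx1 s)) (fun s => (div_le_one hy0).2 (hy1 s))
    (fun r => div_nonneg (hw0 r) hxy.le) (fun s t => by
      rw [div_mul_div_comm, Real.div_rpow (mul_nonneg (hx s) (hy t)) (by positivity)]
      gcongr
      exact hw s t)
  rw [← Finset.sum_div, ← Finset.sum_div, ← Finset.sum_div, div_mul_div_comm,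
    Real.div_rpow (mul_nonneg (Finset.sum_nonneg fun s _ => hx s)
      (Finset.sum_nonneg fun s _ => hy s)) (by positivity)] at this
  exact (div_le_div_iff_of_pos_right hxy).1 this


/-! ### Slicing and induction on the dimension -/

open Classical in
/-- The slice of `A` at height `s` in direction `d`, placed at height zero. -/
noncomputable def slice (A : Finset (ℕ → ℕ)) (d s : ℕ) : Finset (ℕ → ℕ) :=
  (A.filter fun x => x d = s).image fun x => Function.update x d 0

lemma card_slice (A : Finset (ℕ → ℕ)) (d s : ℕ) :
    (slice A d s).card = (A.filter fun x => x d = s).card := by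
  classical
  refine Finset.card_image_of_injOn fun x hx y hy h => ?_
  have hx' := (Finset.mem_filter.1 hx).2
  have hy' := (Finset.mem_filter.1 hy).2
  have := congrArg (fun f => Function.update f d s) h
  simp only [Function.update_idem] at this
  rw [← hx', Function.update_eq_self, hx', ← hy', Function.update_eq_self] at this
  exact this

lemma mem_slice {A : Finset (ℕ → ℕ)} {d s : ℕ} {x : ℕ → ℕ} :
    x ∈ slice A d s ↔ x d = 0 ∧ Function.update x d s ∈ A := by
  classical
  simp only [slice, Finset.mem_image, Finset.mem_filter]
  constructor
  · rintro ⟨y, ⟨hy, rfl⟩, rfl⟩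
    simpa using hy
  · rintro ⟨h0, h⟩
    refine ⟨_, ⟨h, by simp⟩, ?_⟩
    rw [Function.update_idem, ← h0, Function.update_eq_self]

lemma isLowerSet_slice {A : Finset (ℕ → ℕ)} (hA : IsLowerSet (A : Set (ℕ → ℕ))) (d s : ℕ) :
    IsLowerSet (slice A d s : Set (ℕ → ℕ)) := by
  intro x y hyx hx
  obtain ⟨h0, h⟩ := mem_slice.1 hx
  refine mem_slice.2 ⟨Nat.le_zero.1 (h0 ▸ hyx d), hA ?_ h⟩
  exact update_le_update_iff.2 ⟨le_rfl, fun j _ => hyx j⟩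

lemma slice_subset_slice_zero {A : Finset (ℕ → ℕ)} (hA : IsLowerSet (A : Set (ℕ → ℕ)))
    (d s : ℕ) : slice A d s ⊆ slice A d 0 := by
  intro x hx
  obtain ⟨h0, h⟩ := mem_slice.1 hx
  refine mem_slice.2 ⟨h0, hA ?_ h⟩
  exact update_le_update_iff.2 ⟨Nat.zero_le _, fun j _ => le_rfl⟩

open Classical in
lemma slice_add_slice_subset (A B : Finset (ℕ → ℕ)) (d s t : ℕ) :
    slice A d s + slice B d t ⊆ slice (A + B) d (s + t) := by
  intro z hz
  obtain ⟨x, hx, y, hy, rfl⟩ := Finset.mem_add.1 hz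
  obtain ⟨hx0, hx1⟩ := mem_slice.1 hx
  obtain ⟨hy0, hy1⟩ := mem_slice.1 hy
  refine mem_slice.2 ⟨by simp [hx0, hy0], ?_⟩
  rw [Function.update_add]
  exact Finset.add_mem_add hx1 hy1

lemma card_eq_sum_card_slice {A : Finset (ℕ → ℕ)} {d m : ℕ} (h : ∀ x ∈ A, x d < m) :
    A.card = ∑ s ∈ Finset.range m, (slice A d s).card := by
  classical
  rw [Finset.card_eq_sum_card_fiberwise (f := fun x => x d) (t := Finset.range m)
    (fun x hx => Finset.mem_coe.2 (Finset.mem_range.2 (h x hx)))]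
  exact Finset.sum_congr rfl fun s _ => (card_slice A d s).symm

open Classical in
/-- Sums of lower sets in a box of side `M + 1` grow by a power, whatever the dimension. -/
theorem rpow_card_mul_card_le_card_add {ε : ℝ} (hε : 0 < ε) (hε1 : ε ≤ 1 / 25) (M : ℕ)
    (hMε : (100 * ((M + 1 : ℕ) : ℝ)) ^ ε ≤ 1.05) (d : ℕ) (A B : Finset (ℕ → ℕ))
    (hA : IsLowerSet (A : Set (ℕ → ℕ))) (hB : IsLowerSet (B : Set (ℕ → ℕ)))
    (hAd : ∀ x ∈ A, ∀ k, d ≤ k → x k = 0) (hBd : ∀ x ∈ B, ∀ k, d ≤ k → x k = 0)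
    (hAM : ∀ x ∈ A, ∀ k, x k ≤ M) (hBM : ∀ x ∈ B, ∀ k, x k ≤ M) :
    ((A.card : ℝ) * B.card) ^ ((1 + ε) / 2) ≤ (A + B).card := by
  induction d generalizing A B with
  | zero =>
    have hp : (1 + ε) / 2 ≠ 0 := by positivity
    have card_le : ∀ C : Finset (ℕ → ℕ), (∀ x ∈ C, ∀ k, 0 ≤ k → x k = 0) → C.card ≤ 1 := by
      intro C hC
      refine Finset.card_le_one.2 fun x hx y hy => ?_
      funext k
      rw [hC x hx k k.zero_le, hC y hy k k.zero_le]
    rcases A.eq_empty_or_nonempty with rfl | hA0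
    · simp [Real.zero_rpow hp]
    rcases B.eq_empty_or_nonempty with rfl | hB0
    · simp [Real.zero_rpow hp]
    have h1 : (1 : ℝ) ≤ (A + B).card := by exact_mod_cast Finset.card_pos.2 (hA0.add hB0)
    refine le_trans (Real.rpow_le_one (by positivity) ?_ (by positivity)) h1
    have ha : (A.card : ℝ) ≤ 1 := by exact_mod_cast card_le A hAd
    have hb : (B.card : ℝ) ≤ 1 := by exact_mod_cast card_le B hBd
    exact mul_le_one₀ ha (by positivity) hb
  | succ d ih =>
    have hsupp : ∀ C : Finset (ℕ → ℕ), (∀ x ∈ C, ∀ k, d + 1 ≤ k → x k = 0) → ∀ s,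
        ∀ x ∈ slice C d s, ∀ k, d ≤ k → x k = 0 := by
      intro C hC s x hx k hk
      obtain ⟨h0, h⟩ := mem_slice.1 hx
      rcases hk.eq_or_lt with rfl | hk
      · exact h0
      · have := hC _ h k hk
        rwa [Function.update_of_ne (by omega)] at this
    have hbox : ∀ C : Finset (ℕ → ℕ), (∀ x ∈ C, ∀ k, x k ≤ M) → ∀ s,
        ∀ x ∈ slice C d s, ∀ k, x k ≤ M := by
      intro C hC s x hx k
      obtain ⟨h0, h⟩ := mem_slice.1 hx
      rcases eq_or_ne k d with rfl | hk
      · omega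
      · have := hC _ h k
        rwa [Function.update_of_ne hk] at this
    -- The induction hypothesis on pairs of slices is the pointwise hypothesis in one dimension;
    -- nestedness of the slices makes the term at 0 maximal.
    have key := rpow_sum_mul_sum_le_sum hε hε1 (fun s => ((slice A d s).card : ℝ))
      (fun s => ((slice B d s).card : ℝ)) (fun s => ((slice (A + B) d s).card : ℝ)) M hMε
      (fun s => by positivity) (fun s => by positivity)
      (fun s => by exact_mod_cast Finset.card_le_card (slice_subset_slice_zero hA d s))
      (fun s => by exact_mod_cast Finset.card_le_card (slice_subset_slice_zero hB d s))
      (fun s => by positivity)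
      (fun s t => (ih _ _ (isLowerSet_slice hA d s) (isLowerSet_slice hB d t)
        (hsupp A hAd s) (hsupp B hBd t) (hbox A hAM s) (hbox B hBM t)).trans
        (by exact_mod_cast Finset.card_le_card (slice_add_slice_subset A B d s t)))
    have hAB : ∀ z ∈ A + B, z d < M + M + 1 := by
      intro z hz
      obtain ⟨x, hx, y, hy, rfl⟩ := Finset.mem_add.1 hz
      have h1 := hAM x hx d
      have h2 := hBM y hy d
      rw [Pi.add_apply]
      omega
    rw [card_eq_sum_card_slice hAB,
      card_eq_sum_card_slice (A := A) (m := M + 1) fun x hx => Nat.lt_succ_of_le (hAM x hx d),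
      card_eq_sum_card_slice (A := B) (m := M + 1) fun x hx => Nat.lt_succ_of_le (hBM x hx d)]
    push_cast at key ⊢
    exact key

open Classical in
lemma isLowerSet_image_shiftRight {A : Finset (ℕ → ℕ)} (hA : IsLowerSet (A : Set (ℕ → ℕ))) :
    IsLowerSet (A.image shiftRight : Set (ℕ → ℕ)) := by
  intro x y hyx hx
  obtain ⟨a, ha, rfl⟩ := Finset.mem_image.1 hx
  refine Finset.mem_image.2 ⟨fun k => y (k + 1), hA (a := a) (fun k => hyx (k + 1)) ha, ?_⟩
  funext k
  cases k with
  | zero => exact (Nat.le_zero.1 (hyx 0)).symm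
  | succ k => rfl

open Classical in
/-- Power growth of the sum of a lower set with its shift. -/
theorem rpow_half_card_le_card_add_shiftRight {A : Finset (ℕ → ℕ)}
    (hA : IsLowerSet (A : Set (ℕ → ℕ))) {d : ℕ} (hd : ∀ x ∈ A, ∀ k, d ≤ k → x k = 0)
    {ε : ℝ} (hε : 0 < ε) (hε1 : ε ≤ 1 / 25) {M : ℕ}
    (hMε : (100 * ((M + 1 : ℕ) : ℝ)) ^ ε ≤ 1.05)
    (h : 2 * ((Nat.log 2 A.card + 1 : ℕ) : ℝ) * ((A + A.image shiftRight).card : ℝ) ^ 2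
      ≤ ((M + 1 : ℕ) : ℝ) * (A.card : ℝ) ^ 2) :
    ((A.card : ℝ) / 2) ^ (1 + ε) ≤ (A + A.image shiftRight).card := by
  set A' := A.filter fun x => ∀ i, x i < M + 1 with hA'
  have hlow : IsLowerSet (A' : Set (ℕ → ℕ)) := by
    intro x y hyx hx
    obtain ⟨hx1, hx2⟩ := Finset.mem_filter.1 hx
    exact Finset.mem_filter.2 ⟨hA hyx hx1, fun i => (hyx i).trans_lt (hx2 i)⟩
  have hhalf := card_le_two_mul_card_truncation hA hd (Nat.succ_pos M) h
  have hsub : A' ⊆ A := Finset.filter_subset _ _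
  have hbound : ∀ x ∈ A', ∀ k, x k ≤ M := fun x hx k =>
    Nat.lt_succ_iff.1 ((Finset.mem_filter.1 hx).2 k)
  -- Dimension `d + 1` makes room for the shifted set.
  have key := rpow_card_mul_card_le_card_add hε hε1 M hMε (d + 1) A' (A'.image shiftRight) hlow
    (isLowerSet_image_shiftRight hlow)
    (fun x hx k hk => hd x (hsub hx) k (by omega))
    (by
      intro x hx k hk
      obtain ⟨y, hy, rfl⟩ := Finset.mem_image.1 hx
      obtain ⟨k, rfl⟩ : ∃ l, k = l + 1 := ⟨k - 1, by omega⟩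
      exact hd y (hsub hy) k (by omega))
    hbound
    (by
      intro x hx k
      obtain ⟨y, hy, rfl⟩ := Finset.mem_image.1 hx
      cases k with
      | zero => exact Nat.zero_le _
      | succ k => exact hbound y hy k)
  rw [Finset.card_image_of_injective _ shiftRight_injective, ← sq, ← Real.rpow_natCast,
    ← Real.rpow_mul (by positivity)] at key
  calc ((A.card : ℝ) / 2) ^ (1 + ε) ≤ (A'.card : ℝ) ^ (1 + ε) :=
        Real.rpow_le_rpow (by positivity) (by linarith) (by linarith)
    _ ≤ ((A' + A'.image shiftRight).card : ℝ) := by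
        convert key using 2
        push_cast
        ring
    _ ≤ _ := by
        exact_mod_cast Finset.card_le_card (Finset.add_subset_add hsub (Finset.image_subset_image hsub))


/-! ### Choice of parameters and conclusion -/

open Filter in
lemma eventually_log_bounds : ∀ᶠ L : ℝ in atTop,
    1000 ≤ L ∧ 1 ≤ Real.log L ∧ 150 * Real.log L * (1 + 2 * Real.log L) + 1 ≤ L := by
  have h1 := (Real.isLittleO_pow_log_id_atTop (n := 2)).bound (show (0 : ℝ) < 1 / 1000 by norm_num)
  filter_upwards [h1, eventually_ge_atTop 1000,
    Real.tendsto_log_atTop.eventually_ge_atTop 1] with L h2 h3 h4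
  refine ⟨h3, h4, ?_⟩
  rw [Real.norm_of_nonneg (by positivity), id, Real.norm_of_nonneg (by linarith)] at h2
  nlinarith

lemma exp_one_div_le : Real.exp (1 / 25) ≤ 1.05 := by
  have h := Real.add_one_le_exp (-(1 / 25 : ℝ))
  rw [Real.exp_neg] at h
  have hpos := Real.exp_pos (1 / 25 : ℝ)
  have h2 := mul_le_mul_of_nonneg_right h hpos.le
  rw [inv_mul_cancel₀ hpos.ne'] at h2
  linarith

open Classical in
/-- A large lower set has a large sum with its shift. -/
lemma log_sq_mul_card_le_card_add_shiftRight {A : Finset (ℕ → ℕ)}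
    (hA : IsLowerSet (A : Set (ℕ → ℕ))) {d : ℕ} (hd : ∀ x ∈ A, ∀ k, d ≤ k → x k = 0)
    (hpos : 0 < A.card) {L : ℝ} (hL : L = Real.log A.card) (hL1 : 1000 ≤ L)
    (hl : 1 ≤ Real.log L) (hL2 : 150 * Real.log L * (1 + 2 * Real.log L) + 1 ≤ L) :
    L ^ 2 * A.card ≤ (A + A.image shiftRight).card := by
  by_contra! hlt
  set N := (A + A.image shiftRight).card with hN
  set l := Real.log L with hl'
  have hn : (0 : ℝ) < A.card := by exact_mod_cast hpos
  have hlog2 : Real.log 2 < 1 := by linarith [Real.log_two_lt_d9]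
  have hlog2' : 1 / 2 < Real.log 2 := by linarith [Real.log_two_gt_d9]
  have hnatlog : (Nat.log 2 A.card : ℝ) ≤ 2 * L := by
    have h1 : ((2 : ℝ) ^ Nat.log 2 A.card) ≤ A.card := by
      exact_mod_cast Nat.pow_log_le_self 2 hpos.ne'
    have h2 := Real.log_le_log (by positivity) h1
    rw [Real.log_pow, ← hL] at h2
    have h3 : (0 : ℝ) ≤ Nat.log 2 A.card := by positivity
    nlinarith
  -- The box side demanded by truncation when log₂ n ≤ 2L and N < L² n.
  set M := ⌊2 * (2 * L + 1) * L ^ 4⌋₊ with hM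
  have hM0 : 0 ≤ 2 * (2 * L + 1) * L ^ 4 := by positivity
  have hM1 : 2 * (2 * L + 1) * L ^ 4 ≤ ((M + 1 : ℕ) : ℝ) := by
    push_cast
    exact (Nat.lt_floor_add_one _).le
  have hM2 : 100 * ((M + 1 : ℕ) : ℝ) ≤ L ^ 6 := by
    have h1 : (M : ℝ) ≤ 2 * (2 * L + 1) * L ^ 4 := Nat.floor_le hM0
    push_cast
    have h4 : 1 ≤ L ^ 4 := one_le_pow₀ (by linarith)
    have h5 : 100 * (4 * L + 3) ≤ L ^ 2 := by nlinarith
    calc 100 * ((M : ℝ) + 1) ≤ 100 * (4 * L + 3) * L ^ 4 := by nlinarith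
      _ ≤ L ^ 2 * L ^ 4 := by gcongr
      _ = L ^ 6 := by ring
  -- Chosen so that (L⁶)^ε = exp(6/150) = exp(1/25).
  set ε := 1 / (150 * l) with hε
  have hεpos : 0 < ε := by positivity
  have hε1 : ε ≤ 1 / 25 := by
    rw [hε]
    exact one_div_le_one_div_of_le (by norm_num) (by linarith)
  have hMε : (100 * ((M + 1 : ℕ) : ℝ)) ^ ε ≤ 1.05 := by
    refine (Real.rpow_le_rpow (by positivity) hM2 hεpos.le).trans ?_
    refine le_trans (le_of_eq ?_) exp_one_div_le
    rw [Real.rpow_def_of_pos (by positivity), Real.log_pow, ← hl', hε]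
    congr 1
    push_cast
    field_simp
    norm_num
  have key := rpow_half_card_le_card_add_shiftRight hA hd hεpos hε1 hMε (by
    calc 2 * ((Nat.log 2 A.card + 1 : ℕ) : ℝ) * (N : ℝ) ^ 2
        ≤ 2 * (2 * L + 1) * (L ^ 2 * A.card) ^ 2 := by
          push_cast
          gcongr
      _ = (2 * (2 * L + 1) * L ^ 4) * (A.card : ℝ) ^ 2 := by ring
      _ ≤ _ := by gcongr)
  -- Taking logarithms gives ε(L - log 2) < 2l + log 2, hence L - log 2 < 150 l (1 + 2l) ≤ L - 1,
  -- which is absurd.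
  have h1 : Real.log (((A.card : ℝ) / 2) ^ (1 + ε)) < Real.log (L ^ 2 * A.card) :=
    Real.log_lt_log (by positivity) (key.trans_lt hlt)
  rw [Real.log_rpow (by positivity), Real.log_div hn.ne' (by norm_num),
    Real.log_mul (by positivity) hn.ne', Real.log_pow, ← hL, ← hl'] at h1
  push_cast at h1
  have h2 : ε * (L - Real.log 2) < 1 + 2 * l := by linarith
  have h3 : 150 * l * (ε * (L - Real.log 2)) = L - Real.log 2 := by
    rw [hε]
    field_simp
  have h4 := mul_lt_mul_of_pos_left h2 (by positivity : 0 < 150 * l)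
  linarith

/-- For large finite sets of reals, the sum with a transcendental dilate is larger than the set
by at least a squared logarithm. -/
theorem exists_forall_log_sq_mul_card_le_card_add_smul :
    ∃ n₀ : ℕ, ∀ (A : Finset ℝ) (α : ℝ), n₀ ≤ A.card → Transcendental ℚ α →
      1 ≤ Real.log (Real.log A.card) ∧ 1 ≤ Real.log A.card ∧
      Real.log A.card ^ 2 * A.card ≤ ((A + α • A).card : ℝ) := by
  classical
  obtain ⟨n₀, hn₀⟩ := Filter.eventually_atTop.1
    ((Real.tendsto_log_atTop.comp tendsto_natCast_atTop_atTop).eventually eventually_log_bounds)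
  refine ⟨n₀, fun A α hA hα => ?_⟩
  obtain ⟨h1, h2, h3⟩ := hn₀ _ hA
  simp only [Function.comp_apply] at h1 h2 h3
  refine ⟨h2, by linarith, ?_⟩
  obtain ⟨C, d, hCd, hCA, hCle⟩ := exists_sequences_card_add_shiftRight_le A hα
  obtain ⟨B, hB, hBd, hBC, hBle⟩ := exists_isLowerSet_card_add_shiftRight_le C d hCd
  have hBA : B.card = A.card := hBC.trans hCA
  have hpos : 0 < B.card := by
    rw [hBA]
    by_contra h0
    rw [Nat.eq_zero_of_not_pos h0] at h1
    norm_num at h1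
  have := log_sq_mul_card_le_card_add_shiftRight hB hBd hpos (by rw [hBA]) h1 h2 h3
  rw [hBA] at this
  refine this.trans ?_
  have hle := hBle.trans hCle
  exact_mod_cast hle

theorem theorem1p2 :
    ∃ c : ℝ, 0 < c ∧
      ∀ (A : Finset ℝ) (α : ℝ), 3 ≤ A.card → Transcendental ℚ α →
        c * (Real.log (A.card : ℝ) ^ (4 / 3 : ℝ) /
              Real.log (Real.log (A.card : ℝ)) ^ (8 / 3 : ℝ)) * (A.card : ℝ)
          ≤ ((A + α • A).card : ℝ) := by
  obtain ⟨n₀, hn₀⟩ := exists_forall_log_sq_mul_card_le_card_add_smul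
  let F : ℕ → ℝ := fun n =>
    Real.log (n : ℝ) ^ (4 / 3 : ℝ) / Real.log (Real.log (n : ℝ)) ^ (8 / 3 : ℝ)
  -- `S` bounds `F` at every size below `n₀`, where |A + α • A| ≥ |A| suffices. Absolute values keep
  -- `S` nonnegative whatever the sign of `F`.
  set S := ∑ n ∈ Finset.range n₀, |F n| with hS
  have hS0 : 0 ≤ S := Finset.sum_nonneg fun n _ => abs_nonneg _
  refine ⟨1 / (1 + S), by positivity, fun A α hA hα => ?_⟩
  change 1 / (1 + S) * F A.card * A.card ≤ _
  rcases lt_or_ge A.card n₀ with h | h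
  · have h1 : F A.card ≤ S := (le_abs_self _).trans
      (Finset.single_le_sum (f := fun n => |F n|) (fun n _ => abs_nonneg _)
        (Finset.mem_range.2 h))
    have h2 : 1 / (1 + S) * F A.card ≤ 1 := by
      rw [one_div_mul_eq_div, div_le_one (by positivity)]
      linarith
    have hne : (α • A).Nonempty := (Finset.card_pos.1 (by omega)).smul_finset
    have h3 : (A.card : ℝ) ≤ ((A + α • A).card : ℝ) := by
      exact_mod_cast Finset.card_le_card_add_right hne
    calc 1 / (1 + S) * F A.card * A.card ≤ 1 * A.card := by gcongr
      _ ≤ _ := by rwa [one_mul]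
  · obtain ⟨hll, hl, hle⟩ := hn₀ A α h hα
    have hnum : Real.log A.card ^ (4 / 3 : ℝ) ≤ Real.log A.card ^ 2 := by
      rw [← Real.rpow_natCast]
      exact Real.rpow_le_rpow_of_exponent_le hl (by norm_num)
    have hden : 1 ≤ Real.log (Real.log A.card) ^ (8 / 3 : ℝ) :=
      Real.one_le_rpow hll (by norm_num)
    have h1 : F A.card ≤ Real.log A.card ^ 2 := (div_le_self (by positivity) hden).trans hnum
    have h2 : 0 ≤ F A.card := by positivity
    have h3 : 1 / (1 + S) ≤ 1 := by
      rw [div_le_one (by positivity)]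
      linarith
    calc 1 / (1 + S) * F A.card * A.card ≤ 1 * Real.log A.card ^ 2 * A.card := by gcongr
      _ ≤ _ := by rwa [one_mul]
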